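/- Let $G$ be a locally compact, second countable (Hausdorff) topological group with left Haar measure $\mu$, and let $X=\bigoplus_{n\ge 1}L^{2n}(G,\mu)$, the direct sum being taken in the $\ell^2$-sense (with real or complex scalars). Then $X$ is a separable, strictly convex Banach space, and $G$ has a uniform embedding into $X$. More precisely, call a metric on $G$ *plig* if it is proper (closed bounded sets are compact), left invariant, and generates the topology of $G$. Then there exist a plig metric $d$ on $G$, with exponentially controlled growth of balls (there are $\alpha,\beta>0$ with $\mu(\{y : d(e,y)<n\})\le\beta e^{\alpha n}$ for all $n\in\mathbb N$), and a map $b:G\to X$, $b=(b^n)_{n\ge1}$, such that the following hold. 1. For all $g\in G$ and $n\ge 1$, $b^n(g)(h)=\varphi^n(g^{-1}h)-\varphi^n(h)$ for $\mu$-almost every $h\in G$, where $\varphi^n(y)=1-d(e,y)/n$ if $d(e,y)\le n$ and $\varphi^n(y)=0$ otherwise. 2. $b$ is a cocycle for the left regular representation $\tilde\lambda$ of $G$ on $X$, which acts isometrically by $(\tilde\lambda(g)\xi)_n(h)=\xi_n(g^{-1}h)$: one has $b(st)=\tilde\lambda(s)b(t)+b(s)$ for all $s,t\in G$. 3. There are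 constants $c_1,c_2,c_3>0$ such that, for all $g,h\in G$ with $d(g,h)\ge c_3$, $$c_1\sqrt{d(g,h)}\le\|b(g)-b(h)\|_X\le c_2\,d(g,h).$$ 4. $b$ is a uniform embedding of $(G,d')$ into $X$ for every plig metric $d'$ on $G$ (in particular for $d'=d$): there are non-decreasing functions $\rho_-,\rho_+:[0,\infty)\to[0,\infty)$ with $\lim_{t\to\infty}\rho_-(t)=\lim_{t\to\infty}\rho_+(t)=\infty$ such that $\rho_-(d'(g,h))\le\|b(g)-b(h)\|_X\le\rho_+(d'(g,h))$ for all $g,h\in G$. -/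

import Mathlib

open MeasureTheory Filter Topology
open scoped ENNReal

section PligMetrics

/-- A metric `m` on a topological group is a *plig* metric if it is proper (closed bounded sets
are compact), left invariant, and generates the given topology. -/
structure IsPligMetric {G : Type*} [Group G] [t : TopologicalSpace G] (m : MetricSpace G) :
    Prop where
  proper : @ProperSpace G m.toPseudoMetricSpace
  left_invariant : ∀ g x y : G, m.dist (g * x) (g * y) = m.dist x y
  generates : m.toUniformSpace.toTopologicalSpace = t

/-- The balls of the metric `m` have exponentially controlled `μ`-growth:
`μ (B (e, n)) ≤ β * exp (α * n)` for all natural numbers `n`. -/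
def HasExpControlledGrowth {G : Type*} [Group G] [MeasurableSpace G] (m : MetricSpace G)
    (μ : Measure G) : Prop :=
  ∃ α β : ℝ, 0 < α ∧ 0 < β ∧
    ∀ n : ℕ, μ {y : G | m.dist 1 y < n} ≤ ENNReal.ofReal (β * Real.exp (α * n))

/-- Uniform embeddings in the sense of large scale geometry (also called coarse embeddings). This
is not the notion of a uniform embedding of uniform spaces. -/
def IsLargeScaleUniformEmbedding {X Y : Type*} [MetricSpace X] [MetricSpace Y] (f : X → Y) :
    Prop :=
  ∃ ρ₁ ρ₂ : ℝ → ℝ,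
    (∀ t, 0 ≤ t → 0 ≤ ρ₁ t) ∧ (∀ t, 0 ≤ t → 0 ≤ ρ₂ t) ∧
    MonotoneOn ρ₁ (Set.Ici 0) ∧ MonotoneOn ρ₂ (Set.Ici 0) ∧
    Tendsto ρ₁ atTop atTop ∧ Tendsto ρ₂ atTop atTop ∧
    ∀ x y : X, ρ₁ (dist x y) ≤ dist (f x) (f y) ∧ dist (f x) (f y) ≤ ρ₂ (dist x y)

/-- The tent function `φⁿ_e` of the metric `m`: `1 - d(e, y) / n` if `d(e, y) ≤ n`, and `0`
otherwise. -/
noncomputable def tentFunction {G : Type*} [Group G] (m : MetricSpace G) (n : ℕ+) (y : G) : ℝ :=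
  if m.dist 1 y ≤ (n : ℝ) then 1 - m.dist 1 y / (n : ℝ) else 0

end PligMetrics

section DirectSum

/-- The exponent `2n`, for `n ≥ 1`. -/
def evenExponent (n : ℕ+) : ℝ≥0∞ := ((2 * (n : ℕ) : ℕ) : ℝ≥0∞)

instance fact_one_le_evenExponent (n : ℕ+) : Fact (1 ≤ evenExponent n) := by
  refine ⟨?_⟩
  have h : 1 ≤ 2 * (n : ℕ) := by have := n.pos; omega
  unfold evenExponent
  exact_mod_cast h

/-- The Banach space `⨁_{n ≥ 1} L^{2n}(G, μ)`, the direct sum being taken in the `l²`-sense, with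
scalars `𝕜`. -/
abbrev EvenLpSum (𝕜 : Type*) [RCLike 𝕜] {G : Type*} [MeasurableSpace G] (μ : Measure G) : Type _ :=
  lp (fun n : ℕ+ => Lp 𝕜 (evenExponent n) μ) 2

variable (𝕜 : Type*) [RCLike 𝕜] {G : Type*} [Group G] [MeasurableSpace G] [MeasurableMul G]
  (μ : Measure G) [μ.IsMulLeftInvariant]

/-- Left translation on a single `L^p(G, μ)`: `(λ(g) f)(h) = f(g⁻¹h)`. -/
noncomputable def leftTranslateLp (p : ℝ≥0∞) [Fact (1 ≤ p)] (g : G) :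
    Lp 𝕜 p μ →ₗᵢ[𝕜] Lp 𝕜 p μ :=
  Lp.compMeasurePreservingₗᵢ 𝕜 (fun h : G => g⁻¹ * h) (measurePreserving_mul_left μ g⁻¹)

theorem leftTranslateLp_coe (p : ℝ≥0∞) [Fact (1 ≤ p)] (g : G) (f : Lp 𝕜 p μ) :
    (leftTranslateLp 𝕜 μ p g f : G → 𝕜) =ᵐ[μ] fun h => f (g⁻¹ * h) :=
  Lp.coeFn_compMeasurePreserving f (measurePreserving_mul_left μ g⁻¹)

theorem leftTranslateLp_one (p : ℝ≥0∞) [Fact (1 ≤ p)] (f : Lp 𝕜 p μ) :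
    leftTranslateLp 𝕜 μ p (1 : G) f = f := by
  apply Lp.ext
  filter_upwards [leftTranslateLp_coe 𝕜 μ p (1 : G) f] with h hh
  simpa using hh

theorem leftTranslateLp_mul (p : ℝ≥0∞) [Fact (1 ≤ p)] (s t : G) (f : Lp 𝕜 p μ) :
    leftTranslateLp 𝕜 μ p (s * t) f = leftTranslateLp 𝕜 μ p s (leftTranslateLp 𝕜 μ p t f) := by
  apply Lp.ext
  have h2 := (measurePreserving_mul_left μ s⁻¹).quasiMeasurePreserving.ae_eq_comp
    (leftTranslateLp_coe 𝕜 μ p t f)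
  filter_upwards [leftTranslateLp_coe 𝕜 μ p (s * t) f,
    leftTranslateLp_coe 𝕜 μ p s (leftTranslateLp 𝕜 μ p t f), h2] with h a b c
  simp only [Function.comp_apply] at c
  rw [a, b, c, mul_inv_rev, mul_assoc]

/-- The left regular representation of `G` on `⨁_{n ≥ 1} L^{2n}(G, μ)`, by linear isometries, acting
by left translation on each summand. -/
noncomputable def leftRegularRep : G →* (EvenLpSum 𝕜 μ →ₗᵢ[𝕜] EvenLpSum 𝕜 μ) where
  toFun g :=
    { toFun := fun ξ =>
        ⟨fun n => leftTranslateLp 𝕜 μ (evenExponent n) g (ξ n),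
          (lp.memℓp ξ).mono' fun n => by simp⟩
      map_add' := fun ξ η => by ext1; funext n; exact map_add _ _ _
      map_smul' := fun c ξ => by ext1; funext n; simp
      norm_map' := fun ξ => by
        have h2 : (0 : ℝ) < (2 : ℝ≥0∞).toReal := by norm_num
        simp [lp.norm_eq_tsum_rpow h2] }
  map_one' := by
    ext1 ξ; ext1; funext n
    exact leftTranslateLp_one 𝕜 μ _ _
  map_mul' s t := by
    ext1 ξ; ext1; funext n
    exact leftTranslateLp_mul 𝕜 μ _ s t _

end DirectSum

/-!
The construction rests on a plig metric on `G` whose balls grow at most exponentially.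

*The metric.* A function with compact support and a strict maximum at `1` is left uniformly
continuous, so that `ρ x = sup_z |f (z x) - f z|` is the length function of a left invariant metric
that generates the topology (`exists_isCompatibleLength_lt_one_subset_isCompact`); this `ρ` is
bounded. A proper length is obtained as the infimum of `W x₁ + ⋯ + W xₖ` over all factorizations
`x = x₁ * ⋯ * xₖ`, where the weight `W` is `ρ` on `{ρ < 1}`, and is a large constant `v i` on the
`i`-th layer of an exhaustion of `G` by compact symmetric sets `E i`, with `{ρ < 1} ⊆ E 0`. The
length is unchanged near `1` (`isCompatibleLength_chainLength`). Its balls are controlled by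
counting translates of `E 0`: if `E 0 * E i` is covered by at most `2 ^ v i` left translates of
`E 0` and the `v i` are distinct, then the products of elements of the `E i` of total weight `n` are
covered by `4 ^ n` translates (`exists_weights_with_exponential_growth`). The factors from
`{ρ < 1}`, whose number is not controlled by the length, are grouped greedily into blocks
(`exists_mul_eq_list_prod`).

*The cocycle.* The `n`-th component `φⁿ(g⁻¹ ·) - φⁿ` of `b g` is bounded by `d(1, g) / n` and
supported in two balls of radius `n`. Their measure is exponential in `n`, so the `2n`-th root in
the `L^{2n}` norm turns it into a constant (`eLpNorm_tentFunction_sub_le`), and the `ℓ²`-sum of the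
bounds is linear in `d(1, g)`. Conversely, each `n ≤ d(1, g) / 2` contributes a constant, because
the two tents are disjoint (`le_eLpNorm_tentFunction_sub`), whence a lower bound of the order of
`√(d(1, g))`.

*Other plig metrics* have the same bounded sets, namely the relatively compact ones, which is all
that the existence of control functions depends on (`exists_monotone_controls`).

*Strict convexity* of `L^p` spaces and of `ℓ^p`-sums is proved from the strict midpoint inequality
`(‖a + b‖ / 2) ^ p < (‖a‖ ^ p + ‖b‖ ^ p) / 2` for `a ≠ b` (`half_norm_add_rpow_lt`), integrated or
summed.
-/

/-! ### Strict convexity of `L^p` spaces and of `ℓ^p`-sums -/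

section StrictConvexity

theorem half_norm_add_rpow_le {E : Type*} [NormedAddCommGroup E] {p : ℝ} (hp : 1 ≤ p) (a b : E) :
    (‖a + b‖ / 2) ^ p ≤ (‖a‖ ^ p + ‖b‖ ^ p) / 2 := by
  have h1 : (‖a + b‖ / 2) ^ p ≤ (1 / 2 * ‖a‖ + 1 / 2 * ‖b‖) ^ p := by
    refine Real.rpow_le_rpow (by positivity) ?_ (by linarith)
    linarith [norm_add_le a b]
  have h2 := (convexOn_rpow hp).2 (norm_nonneg a) (norm_nonneg b)
    (by norm_num : (0 : ℝ) ≤ 1 / 2) (by norm_num : (0 : ℝ) ≤ 1 / 2) (by norm_num)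
  simp only [smul_eq_mul] at h2
  linarith

/-- Two reasons make the inequality strict: if `‖a‖ ≠ ‖b‖`, the strict convexity of `t ↦ t ^ p`,
and if `‖a‖ = ‖b‖`, the strict convexity of the norm. -/
theorem half_norm_add_rpow_lt {E : Type*} [NormedAddCommGroup E] [NormedSpace ℝ E]
    [StrictConvexSpace ℝ E] {p : ℝ} (hp : 1 < p) {a b : E} (hab : a ≠ b) :
    (‖a + b‖ / 2) ^ p < (‖a‖ ^ p + ‖b‖ ^ p) / 2 := by
  rcases eq_or_ne ‖a‖ ‖b‖ with h | h
  · have h1 : ‖a + b‖ / 2 < ‖a‖ := by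
      have := (norm_add_lt_of_not_sameRay (mt (sameRay_iff_of_norm_eq h).1 hab))
      linarith
    have := Real.rpow_lt_rpow (by positivity) h1 (by linarith : 0 < p)
    rw [← h]
    linarith
  · have h1 : (‖a + b‖ / 2) ^ p ≤ (1 / 2 * ‖a‖ + 1 / 2 * ‖b‖) ^ p := by
      refine Real.rpow_le_rpow (by positivity) ?_ (by linarith)
      linarith [norm_add_le a b]
    have h2 := (strictConvexOn_rpow hp).2 (norm_nonneg a) (norm_nonneg b) h
      (by norm_num : (0 : ℝ) < 1 / 2) (by norm_num : (0 : ℝ) < 1 / 2) (by norm_num)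
    simp only [smul_eq_mul] at h2
    linarith

theorem MeasureTheory.Lp.strictConvexSpace {α E : Type*} [MeasurableSpace α] (μ : Measure α)
    [NormedAddCommGroup E] [NormedSpace ℝ E] [StrictConvexSpace ℝ E] (p : ℝ≥0∞) [Fact (1 ≤ p)]
    (h1p : 1 < p) (hp : p ≠ ∞) : StrictConvexSpace ℝ (Lp E p μ) := by
  have hp1 : 1 < p.toReal := by
    rw [← ENNReal.toReal_one]
    exact (ENNReal.toReal_lt_toReal ENNReal.one_ne_top hp).2 h1p
  have hp0 : p ≠ 0 := (zero_lt_one.trans h1p).ne'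
  have hnorm : ∀ f : Lp E p μ, ‖f‖ ^ p.toReal = ∫ x, ‖f x‖ ^ p.toReal ∂μ := fun f => by
    have hnn : 0 ≤ ∫ x, ‖f x‖ ^ p.toReal ∂μ := integral_nonneg fun x => by positivity
    rw [Lp.norm_def, (Lp.memLp f).eLpNorm_eq_integral_rpow_norm hp0 hp,
      ENNReal.toReal_ofReal (by positivity), ← Real.rpow_mul hnn,
      inv_mul_cancel₀ (by linarith), Real.rpow_one]
  have hint : ∀ f : Lp E p μ, Integrable (fun x => ‖f x‖ ^ p.toReal) μ := fun f =>
    (Lp.memLp f).integrable_norm_rpow hp0 hp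
  refine StrictConvexSpace.of_norm_add_ne_two fun f g hf hg hne hfg => hne ?_
  -- the pointwise midpoint defect is non-negative and has integral zero, so it vanishes a.e.
  let D : α → ℝ := fun x => (‖f x‖ ^ p.toReal + ‖g x‖ ^ p.toReal) / 2 -
    ‖(f + g) x‖ ^ p.toReal / 2 ^ p.toReal
  have hD : ∀ᵐ x ∂μ, D x =
      (‖f x‖ ^ p.toReal + ‖g x‖ ^ p.toReal) / 2 - (‖f x + g x‖ / 2) ^ p.toReal := by
    filter_upwards [Lp.coeFn_add f g] with x hx
    simp only [D]
    rw [hx, Pi.add_apply, Real.div_rpow (norm_nonneg _) zero_le_two]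
  have hD0 : 0 ≤ᵐ[μ] D := by
    filter_upwards [hD] with x hx
    rw [hx]
    exact sub_nonneg.2 (half_norm_add_rpow_le hp1.le _ _)
  have hDi : Integrable D μ :=
    (((hint f).add (hint g)).div_const 2).sub ((hint (f + g)).div_const _)
  have hI : ∫ x, D x ∂μ = 0 := by
    have h2 : (2 : ℝ) ^ p.toReal ≠ 0 := by positivity
    have h3 : ∫ x, D x ∂μ = (∫ x, ‖f x‖ ^ p.toReal ∂μ + ∫ x, ‖g x‖ ^ p.toReal ∂μ) / 2 -
        (∫ x, ‖(f + g) x‖ ^ p.toReal ∂μ) / 2 ^ p.toReal := by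
      rw [← integral_add (hint f) (hint g), ← integral_div, ← integral_div]
      exact integral_sub (((hint f).add (hint g)).div_const 2) ((hint (f + g)).div_const _)
    rw [h3, ← hnorm, ← hnorm, ← hnorm, hf, hg, hfg, Real.one_rpow, div_self h2]
    norm_num
  have hz := (integral_eq_zero_iff_of_nonneg_ae hD0 hDi).1 hI
  apply Lp.ext
  filter_upwards [hz, hD] with x hx0 hx
  by_contra hxne
  have := half_norm_add_rpow_lt hp1 hxne
  rw [hx] at hx0
  simp only [Pi.zero_apply] at hx0
  linarith

theorem lp.strictConvexSpace {ι : Type*} (E : ι → Type*) [∀ i, NormedAddCommGroup (E i)]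
    [∀ i, NormedSpace ℝ (E i)] [∀ i, StrictConvexSpace ℝ (E i)] (p : ℝ≥0∞) [Fact (1 ≤ p)]
    (h1p : 1 < p) (hp : p ≠ ∞) : StrictConvexSpace ℝ (lp E p) := by
  have hp1 : 1 < p.toReal := by
    rw [← ENNReal.toReal_one]
    exact (ENNReal.toReal_lt_toReal ENNReal.one_ne_top hp).2 h1p
  have hp0 : 0 < p.toReal := by linarith
  refine StrictConvexSpace.of_norm_add_ne_two fun f g hf hg hne hfg => ?_
  obtain ⟨i, hi⟩ : ∃ i, f i ≠ g i := by
    by_contra! h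
    exact hne (lp.ext (funext h))
  have h1 := ((lp.hasSum_norm hp0 f).add (lp.hasSum_norm hp0 g)).div_const 2
  have h2 := (lp.hasSum_norm hp0 (f + g)).div_const ((2 : ℝ) ^ p.toReal)
  have hle : ∀ j, ‖(f + g) j‖ ^ p.toReal / 2 ^ p.toReal ≤
      (‖f j‖ ^ p.toReal + ‖g j‖ ^ p.toReal) / 2 := fun j => by
    rw [← Real.div_rpow (norm_nonneg _) zero_le_two]
    exact half_norm_add_rpow_le hp1.le _ _
  have hlt : ‖(f + g) i‖ ^ p.toReal / 2 ^ p.toReal <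
      (‖f i‖ ^ p.toReal + ‖g i‖ ^ p.toReal) / 2 := by
    rw [← Real.div_rpow (norm_nonneg _) zero_le_two]
    exact half_norm_add_rpow_lt hp1 hi
  have := hasSum_lt hle hlt h2 h1
  have h2' : (2 : ℝ) ^ p.toReal ≠ 0 := by positivity
  rw [hf, hg, hfg, Real.one_rpow, div_self h2'] at this
  norm_num at this

end StrictConvexity

/-! ### Separability of countable `ℓ^p`-sums -/

theorem lp.separableSpace {ι : Type*} [Countable ι] (E : ι → Type*)
    [∀ i, NormedAddCommGroup (E i)] [∀ i, NormedSpace ℝ (E i)]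
    [∀ i, TopologicalSpace.SeparableSpace (E i)] (p : ℝ≥0∞) [Fact (1 ≤ p)] (hp : p ≠ ∞) :
    TopologicalSpace.SeparableSpace (lp E p) := by
  classical
  have h1 : TopologicalSpace.IsSeparable
      (⋃ i, Set.range fun a : E i => lp.single p i a) :=
    .iUnion fun i => TopologicalSpace.isSeparable_range
      (lp.singleContinuousLinearMap ℝ E p i).continuous
  have h2 := (h1.span (R := ℝ)).closure
  rw [← TopologicalSpace.isSeparable_univ_iff]
  refine h2.mono fun f _ => ?_
  refine mem_closure_of_tendsto (lp.hasSum_single hp f) (Eventually.of_forall fun s => ?_)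
  exact Submodule.sum_mem _ fun i _ => Submodule.subset_span (Set.mem_iUnion.2 ⟨i, f i, rfl⟩)

theorem one_lt_evenExponent (n : ℕ+) : 1 < evenExponent n := by
  have h : 1 < 2 * (n : ℕ) := by have := n.pos; omega
  unfold evenExponent
  exact_mod_cast h

theorem evenExponent_ne_top (n : ℕ+) : evenExponent n ≠ ∞ := ENNReal.natCast_ne_top _

theorem strictConvexSpace_evenLpSum (𝕜 : Type*) [RCLike 𝕜] {G : Type*} [MeasurableSpace G]
    (μ : Measure G) : StrictConvexSpace ℝ (EvenLpSum 𝕜 μ) := by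
  have : ∀ n : ℕ+, StrictConvexSpace ℝ (Lp 𝕜 (evenExponent n) μ) := fun n =>
    Lp.strictConvexSpace μ _ (one_lt_evenExponent n) (evenExponent_ne_top n)
  exact lp.strictConvexSpace _ 2 (by norm_num) (by norm_num)

theorem separableSpace_evenLpSum (𝕜 : Type*) [RCLike 𝕜] {G : Type*} [MeasurableSpace G]
    (μ : Measure G) [IsSeparable μ] : TopologicalSpace.SeparableSpace (EvenLpSum 𝕜 μ) := by
  have : ∀ n : ℕ+, Fact (evenExponent n ≠ ∞) := fun n => ⟨evenExponent_ne_top n⟩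
  have : ∀ n : ℕ+, TopologicalSpace.SeparableSpace (Lp 𝕜 (evenExponent n) μ) := fun n =>
    inferInstance
  exact lp.separableSpace _ 2 (by norm_num)

/-! ### Length functions and left invariant metrics -/

section LengthFunctions

/-- A symmetric subadditive function on a topological group, vanishing at `1`, whose sublevel sets
`{x | ℓ x < ε}`, `ε > 0`, form a basis of the neighbourhoods of `1`. These are the functions
`d 1 ·`, for `d` a left invariant metric that generates the topology. -/
structure IsCompatibleLength {G : Type*} [Group G] [TopologicalSpace G] (ℓ : G → ℝ) : Prop where
  one : ℓ 1 = 0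
  inv : ∀ x, ℓ x⁻¹ = ℓ x
  mul_le : ∀ x y, ℓ (x * y) ≤ ℓ x + ℓ y
  hasBasis : (𝓝 (1 : G)).HasBasis (fun ε : ℝ => 0 < ε) fun ε => {x | ℓ x < ε}

namespace IsCompatibleLength

variable {G : Type*} [Group G] [TopologicalSpace G] {ℓ : G → ℝ}

theorem nonneg (h : IsCompatibleLength ℓ) (x : G) : 0 ≤ ℓ x := by
  have := h.mul_le x x⁻¹
  rw [mul_inv_cancel, h.one, h.inv] at this
  linarith

theorem list_prod_le (h : IsCompatibleLength ℓ) (l : List G) : ℓ l.prod ≤ (l.map ℓ).sum := by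
  induction l with
  | nil => simp [h.one]
  | cons x l ih =>
    simp only [List.prod_cons, List.map_cons, List.sum_cons]
    linarith [h.mul_le x l.prod]

theorem eq_one [T1Space G] (h : IsCompatibleLength ℓ) {x : G} (hx : ℓ x = 0) : x = 1 := by
  by_contra hne
  obtain ⟨ε, hε, hsub⟩ := h.hasBasis.mem_iff.1 (isOpen_compl_singleton.mem_nhds (Ne.symm hne))
  exact hsub (show ℓ x < ε by rwa [hx]) rfl

variable [IsTopologicalGroup G] [T2Space G]

/-- The left invariant metric `d x y = ℓ (x⁻¹ * y)` of a compatible length function `ℓ`. Its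
topology is the given one by definition. -/
@[reducible] noncomputable def metricSpace (h : IsCompatibleLength ℓ) : MetricSpace G :=
  MetricSpace.ofDistTopology (fun x y => ℓ (x⁻¹ * y)) (fun x => by simp [h.one])
    (fun x y => by rw [← h.inv, mul_inv_rev, inv_inv])
    (fun x y z => by simpa [mul_assoc] using h.mul_le (x⁻¹ * y) (y⁻¹ * z))
    (fun s => by
      rw [isOpen_iff_mem_nhds]
      refine forall₂_congr fun x _ => ?_
      rw [← map_mul_left_nhds_one, mem_map, h.hasBasis.mem_iff]
      refine exists_congr fun ε => and_congr_right fun _ =>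
        ⟨fun hs y hy => by simpa using hs hy, fun hs y hy => hs _ ?_⟩
      simpa using hy)
    (fun x y hxy => (inv_mul_eq_one.1 (h.eq_one hxy)))

theorem metricSpace_dist (h : IsCompatibleLength ℓ) (x y : G) :
    h.metricSpace.dist x y = ℓ (x⁻¹ * y) := rfl

theorem isPligMetric (h : IsCompatibleLength ℓ)
    (hc : ∀ r, ∃ K : Set G, IsCompact K ∧ {x | ℓ x ≤ r} ⊆ K) : IsPligMetric h.metricSpace where
  proper := by
    let _ := h.metricSpace
    refine ⟨fun x r => ?_⟩
    obtain ⟨K, hK, hsub⟩ := hc r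
    refine (hK.image (continuous_const_mul x)).of_isClosed_subset Metric.isClosed_closedBall
      fun y hy => ⟨x⁻¹ * y, hsub ?_, by simp⟩
    rw [Metric.mem_closedBall'] at hy
    exact hy
  left_invariant g x y := by
    rw [metricSpace_dist, metricSpace_dist]
    congr 1
    group
  generates := rfl

end IsCompatibleLength

/-- A compactly supported function with a strict maximum at `1`: truncate the distance to `1` in
some metric of the underlying space. -/
theorem exists_bump_with_hasBasis (G : Type*) [Group G] [TopologicalSpace G] [T2Space G]
    [LocallyCompactSpace G] [SecondCountableTopology G] :
    ∃ f : G → ℝ, Continuous f ∧ HasCompactSupport f ∧ f 1 = 1 ∧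
      ∀ U ∈ 𝓝 (1 : G), ∃ ε > 0, ∀ x, 1 - f x < ε → x ∈ U := by
  let _ := TopologicalSpace.metrizableSpaceMetric G
  obtain ⟨r, hr, hK⟩ := Metric.exists_isCompact_closedBall (1 : G)
  refine ⟨fun x => max 0 (1 - dist x 1 / r), by fun_prop, ?_, by simp,
    fun U hU => ?_⟩
  · refine HasCompactSupport.intro hK fun x hx => max_eq_left ?_
    rw [Metric.mem_closedBall, not_le] at hx
    linarith [(one_lt_div hr).2 hx]
  · obtain ⟨δ, hδ, hball⟩ := Metric.mem_nhds_iff.1 hU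
    refine ⟨min 1 (δ / r), by positivity, fun x hx => hball ?_⟩
    simp only [lt_min_iff] at hx
    rcases max_cases 0 (1 - dist x 1 / r) with ⟨h1, _⟩ | ⟨h1, _⟩
    · linarith [hx.1]
    · rw [h1] at hx
      exact Metric.mem_ball.2 ((div_lt_div_iff_of_pos_right hr).1 (by linarith [hx.2]))

/-- Left uniform continuity of a compactly supported function makes `x ↦ sup_z |f (z x) - f z|` a
compatible length as soon as `f` determines the neighbourhoods of `1`. -/
theorem exists_isCompatibleLength_lt_one_subset_isCompact (G : Type*) [Group G]
    [TopologicalSpace G] [IsTopologicalGroup G] [T2Space G] [LocallyCompactSpace G]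
    [SecondCountableTopology G] :
    ∃ ρ : G → ℝ, IsCompatibleLength ρ ∧ ∃ K : Set G, IsCompact K ∧ {x | ρ x < 1} ⊆ K := by
  obtain ⟨f, hfc, hfs, hf1, hfU⟩ := exists_bump_with_hasBasis G
  obtain ⟨C, hC⟩ := hfc.bounded_above_of_compact_support hfs
  have hbdd : ∀ x, BddAbove (Set.range fun z => |f (z * x) - f z|) := fun x => by
    refine ⟨C + C, ?_⟩
    rintro _ ⟨z, rfl⟩
    exact (abs_sub _ _).trans (add_le_add (hC _) (hC _))
  have hle : ∀ x z, |f (z * x) - f z| ≤ ⨆ z, |f (z * x) - f z| := fun x z => le_ciSup (hbdd x) z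
  have hlow : ∀ x, 1 - f x ≤ ⨆ z, |f (z * x) - f z| := fun x => by
    refine le_trans ?_ (hle x 1)
    rw [one_mul, hf1, abs_sub_comm]
    exact le_abs_self _
  refine ⟨fun x => ⨆ z, |f (z * x) - f z|,
    ⟨by simp, fun x => ?_, fun x y => ?_, ⟨fun U => ⟨?_, ?_⟩⟩⟩,
    tsupport f, hfs, fun x hx => subset_tsupport f ?_⟩
  · refine (Equiv.mulRight x⁻¹).iSup_congr fun z => ?_
    simp only [Equiv.coe_mulRight, inv_mul_cancel_right]
    exact abs_sub_comm _ _
  · refine ciSup_le fun z => ?_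
    have h1 := hle y (z * x)
    have h2 := hle x z
    rw [mul_assoc] at h1
    have := abs_sub_le (f (z * (x * y))) (f (z * x)) (f z)
    linarith
  · intro hU
    obtain ⟨ε, hε, h⟩ := hfU U hU
    exact ⟨ε, hε, fun x hx => h x ((hlow x).trans_lt hx)⟩
  · rintro ⟨ε, hε, hsub⟩
    refine mem_of_superset ?_ hsub
    let _ := IsTopologicalGroup.leftUniformSpace G
    have huc := hfs.uniformContinuous_of_continuous hfc
    have h1 := huc (Metric.dist_mem_uniformity (half_pos hε))
    obtain ⟨V, hV, hVsub⟩ := h1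
    filter_upwards [hV] with x hx
    refine lt_of_le_of_lt (ciSup_le fun z => ?_) (half_lt_self hε)
    have h2 : ((z, z * x) : G × G) ∈ (fun p : G × G => p.1⁻¹ * p.2) ⁻¹' V := by simpa using hx
    have h3 : dist (f z) (f (z * x)) < ε / 2 := hVsub h2
    rw [dist_comm, Real.dist_eq] at h3
    exact h3.le
  · intro h0
    have := hlow x
    rw [h0] at this
    exact absurd hx (not_lt.2 (by simpa using this))

end LengthFunctions

/-! ### The length function of a weight -/

section ChainLength

theorem sum_map_nonneg_of_nonneg {α : Type*} {W : α → ℝ} (hW : ∀ x, 0 ≤ W x) (l : List α) :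
    0 ≤ (l.map W).sum :=
  List.sum_nonneg fun a ha => by
    obtain ⟨x, _, rfl⟩ := List.mem_map.1 ha
    exact hW x

variable {G : Type*} [Group G]

/-- The infimum of `W x₁ + ⋯ + W xₖ` over all factorizations `x = x₁ * ⋯ * xₖ`, the empty one
included if `x = 1`. For `W ≥ 0`, it is the greatest subadditive function below `W` that vanishes
at `1`. -/
noncomputable def chainLength (W : G → ℝ) (x : G) : ℝ :=
  ⨅ l : {l : List G // l.prod = x}, (l.1.map W).sum

variable {W : G → ℝ}

theorem chainLength_le_sum (hW : ∀ x, 0 ≤ W x) (l : List G) :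
    chainLength W l.prod ≤ (l.map W).sum :=
  ciInf_le (f := fun l' : {l' : List G // l'.prod = l.prod} => (l'.1.map W).sum)
    ⟨0, by rintro _ ⟨l, rfl⟩; exact sum_map_nonneg_of_nonneg hW _⟩ ⟨l, rfl⟩

theorem chainLength_le (hW : ∀ x, 0 ≤ W x) (x : G) : chainLength W x ≤ W x := by
  simpa using chainLength_le_sum hW [x]

theorem exists_sum_lt_of_chainLength_lt {x : G} {s : ℝ} (h : chainLength W x < s) :
    ∃ l : List G, l.prod = x ∧ (l.map W).sum < s := by
  have : Nonempty {l : List G // l.prod = x} := ⟨⟨[x], by simp⟩⟩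
  obtain ⟨l, hl⟩ := exists_lt_of_ciInf_lt h
  exact ⟨l.1, l.2, hl⟩

theorem chainLength_one (hW : ∀ x, 0 ≤ W x) : chainLength W 1 = 0 :=
  le_antisymm (by simpa using chainLength_le_sum hW [])
    (Real.iInf_nonneg fun l => sum_map_nonneg_of_nonneg hW _)

theorem chainLength_mul_le (hW : ∀ x, 0 ≤ W x) (x y : G) :
    chainLength W (x * y) ≤ chainLength W x + chainLength W y := by
  refine le_of_forall_pos_lt_add fun ε hε => ?_
  obtain ⟨l₁, rfl, h₁⟩ := exists_sum_lt_of_chainLength_lt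
    (lt_add_of_pos_right (chainLength W x) (half_pos hε))
  obtain ⟨l₂, rfl, h₂⟩ := exists_sum_lt_of_chainLength_lt
    (lt_add_of_pos_right (chainLength W y) (half_pos hε))
  have := chainLength_le_sum hW (l₁ ++ l₂)
  rw [List.prod_append, List.map_append, List.sum_append] at this
  linarith

theorem chainLength_inv (hW : ∀ x, 0 ≤ W x) (hinv : ∀ x, W x⁻¹ = W x) (x : G) :
    chainLength W x⁻¹ = chainLength W x := by
  have key : ∀ x, chainLength W x⁻¹ ≤ chainLength W x := fun x => by
    refine le_of_forall_gt fun s hs => ?_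
    obtain ⟨l, rfl, hl⟩ := exists_sum_lt_of_chainLength_lt hs
    rw [List.prod_inv_reverse]
    refine (chainLength_le_sum hW _).trans_lt ?_
    rwa [List.map_reverse, List.sum_reverse, List.map_map,
      show W ∘ (fun x => x⁻¹) = W from funext hinv]
  exact le_antisymm (key x) (by simpa using key x⁻¹)

/-- If the weight coincides with a compatible length `ρ` where `ρ < 1` and is at least `1`
elsewhere, then chains of total weight less than `1` only see `ρ`, so that the chain length is a
compatible length too. -/
theorem isCompatibleLength_chainLength [TopologicalSpace G] {ρ : G → ℝ}
    (hρ : IsCompatibleLength ρ) (hinv : ∀ x, W x⁻¹ = W x) (hlt : ∀ x, ρ x < 1 → W x = ρ x)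
    (hge : ∀ x, 1 ≤ ρ x → 1 ≤ W x) : IsCompatibleLength (chainLength W) := by
  have hW : ∀ x, 0 ≤ W x := fun x => by
    rcases lt_or_ge (ρ x) 1 with h | h
    · exact (hρ.nonneg x).trans_eq (hlt x h).symm
    · exact zero_le_one.trans (hge x h)
  refine ⟨chainLength_one hW, chainLength_inv hW hinv, chainLength_mul_le hW,
    hρ.hasBasis.to_hasBasis (fun ε hε => ⟨min ε 1, by positivity, fun x hx => ?_⟩)
      fun ε hε => ⟨min ε 1, by positivity, fun x hx => ?_⟩⟩
  · obtain ⟨l, rfl, hl⟩ := exists_sum_lt_of_chainLength_lt hx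
    have h1 : ∀ y ∈ l, ρ y = W y := fun y hy => by
      refine (hlt y (not_le.1 fun hy1 => ?_)).symm
      have h2 : W y ≤ (l.map W).sum :=
        List.single_le_sum (fun a ha => by
          obtain ⟨x, _, rfl⟩ := List.mem_map.1 ha
          exact hW x) _ (List.mem_map_of_mem hy)
      linarith [hge y hy1, min_le_right ε 1]
    have h2 := hρ.list_prod_le l
    rw [List.map_congr_left h1] at h2
    exact h2.trans_lt (hl.trans_le (min_le_left _ _))
  · have hx' : ρ x < min ε 1 := hx
    exact ((chainLength_le hW x).trans_eq (hlt x (hx'.trans_le (min_le_right _ _)))).trans_lt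
      (hx'.trans_le (min_le_left _ _))

end ChainLength

/-! ### Metrics with exponentially controlled growth -/

section ExponentialGrowth

open scoped Pointwise

variable {G : Type*} [Group G]

open Classical in
/-- For strictly increasing positive weights `v`, the set of all products `x₁ * ⋯ * xₖ` with
`xⱼ ∈ F iⱼ` and `v i₁ + ⋯ + v iₖ ≤ n`. The weight may be less than `n` since `1` belongs to each of
these sets. -/
noncomputable def weightedProducts (v : ℕ → ℕ) (F : ℕ → Finset G) : ℕ → Finset G
  | n => insert 1 ((Finset.range n).attach.biUnion fun k =>
      {i ∈ Finset.range (n + 1) | (k : ℕ) + v i = n}.biUnion fun i =>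
        have := Finset.mem_range.1 k.2
        weightedProducts v F k * F i)

theorem one_mem_weightedProducts (v : ℕ → ℕ) (F : ℕ → Finset G) (n : ℕ) :
    1 ∈ weightedProducts v F n := by
  classical
  rw [weightedProducts]
  exact Finset.mem_insert_self _ _

theorem mul_mem_weightedProducts {v : ℕ → ℕ} (hv : StrictMono v) (hv1 : ∀ i, 1 ≤ v i)
    {F : ℕ → Finset G} {n i : ℕ} {x y : G} (hx : x ∈ weightedProducts v F n) (hy : y ∈ F i) :
    x * y ∈ weightedProducts v F (n + v i) := by
  classical
  rw [weightedProducts]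
  refine Finset.mem_insert_of_mem (Finset.mem_biUnion.2 ⟨⟨n, ?_⟩, Finset.mem_attach _ _,
    Finset.mem_biUnion.2 ⟨i, ?_, ?_⟩⟩)
  · have := hv1 i
    simp only [Finset.mem_range]
    omega
  · have := hv.le_apply (x := i)
    simp only [Finset.mem_filter, Finset.mem_range, and_true]
    omega
  · convert Finset.mul_mem_mul hx hy

/-- The bound `1 + ∑ k < n, 4 ^ k * 2 ^ (n - k) ≤ 4 ^ n` makes the induction work: by injectivity
of `v`, at most one index `i` satisfies `k + v i = n`, and it contributes at most
`#(F i) ≤ 2 ^ v i = 2 ^ (n - k)` factors. -/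
theorem card_weightedProducts_le {v : ℕ → ℕ} (hv : StrictMono v) {F : ℕ → Finset G}
    (hF : ∀ i, (F i).card ≤ 2 ^ v i) (n : ℕ) : (weightedProducts v F n).card ≤ 4 ^ n := by
  classical
  induction n using Nat.strong_induction_on with
  | _ n ih =>
    have hk : ∀ k ∈ (Finset.range n).attach,
        ({i ∈ Finset.range (n + 1) | (k : ℕ) + v i = n}.biUnion fun i =>
          weightedProducts v F k * F i).card ≤ 2 ^ n * 2 ^ (k : ℕ) := fun k _ => by
      have hkn := Finset.mem_range.1 k.2
      have h1 : {i ∈ Finset.range (n + 1) | (k : ℕ) + v i = n}.card ≤ 1 := by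
        refine Finset.card_le_one.2 fun i hi j hj => hv.injective ?_
        have := (Finset.mem_filter.1 hi).2
        have := (Finset.mem_filter.1 hj).2
        omega
      refine (Finset.card_biUnion_le_card_mul _ _ (2 ^ n * 2 ^ (k : ℕ)) fun i hi => ?_).trans
        (by simpa using Nat.mul_le_mul_right (2 ^ n * 2 ^ (k : ℕ)) h1)
      have hi := (Finset.mem_filter.1 hi).2
      calc (weightedProducts v F k * F i).card
          ≤ (weightedProducts v F k).card * (F i).card := Finset.card_mul_le
        _ ≤ 4 ^ (k : ℕ) * 2 ^ v i := Nat.mul_le_mul (ih k hkn) (hF i)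
        _ = 2 ^ n * 2 ^ (k : ℕ) := by
          rw [show (4 : ℕ) = 2 * 2 by norm_num, mul_pow]
          have h2 : 2 ^ n = 2 ^ (k : ℕ) * 2 ^ v i := by rw [← pow_add, hi]
          rw [h2]
          ring
    rw [weightedProducts]
    refine (Finset.card_insert_le _ _).trans ?_
    have h2 : ∑ k ∈ (Finset.range n).attach, 2 ^ n * 2 ^ (k : ℕ) = 2 ^ n * (2 ^ n - 1) := by
      rw [Finset.sum_attach (Finset.range n) fun k => 2 ^ n * 2 ^ k, ← Finset.mul_sum,
        Nat.geomSum_eq le_rfl]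
      simp
    have h3 := (Finset.card_biUnion_le (s := (Finset.range n).attach)
      (t := fun k => {i ∈ Finset.range (n + 1) | (k : ℕ) + v i = n}.biUnion fun i =>
          weightedProducts v F k * F i)).trans ((Finset.sum_le_sum hk).trans_eq h2)
    have h4 : 2 ^ n * (2 ^ n - 1) + 1 ≤ 4 ^ n := by
      have h5 : 1 ≤ 2 ^ n := Nat.one_le_two_pow
      obtain ⟨m, hm⟩ := Nat.exists_eq_add_of_le h5
      rw [show (4 : ℕ) = 2 * 2 by norm_num, mul_pow, hm, Nat.add_sub_cancel_left]
      nlinarith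
    refine le_trans (Nat.add_le_add_right ?_ 1) h4
    convert h3

variable [TopologicalSpace G] [IsTopologicalGroup G] [MeasurableSpace G]

/-- Compact sets `E i` admit weights `v i` so large that the products of elements of the `E i` of
total weight `n` stay in a compact set whose measure is at most exponential in `n`. The weight
`v i` has to exceed the number of left translates of `E 0` needed to cover `E 0 * E i`: then the
products of weight `n` are covered by the translates of `E 0` by `weightedProducts v F n`. -/
theorem exists_weights_with_exponential_growth (μ : Measure G) [μ.IsHaarMeasure] {E : ℕ → Set G}
    (hE : ∀ i, IsCompact (E i)) (hE1 : 1 ∈ E 0) (hE0 : (interior (E 0)).Nonempty) :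
    ∃ (v : ℕ → ℕ) (T : ℕ → Set G), (∀ i, 1 ≤ v i) ∧ (∀ n, IsCompact (T n)) ∧ 1 ∈ T 0 ∧
      (∀ n i, T n * E i ⊆ T (n + v i)) ∧ ∀ n, μ (T n) ≤ 4 ^ n * μ (E 0) := by
  classical
  have hcov : ∀ i, ∃ F : Finset G, E 0 * E i ⊆ (F : Set G) * E 0 := fun i => by
    obtain ⟨t, ht⟩ := compact_covered_by_mul_left_translates ((hE 0).mul (hE i)) hE0
    refine ⟨t⁻¹, fun x hx => ?_⟩
    obtain ⟨g, hg, hgx⟩ := Set.mem_iUnion₂.1 (ht hx)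
    exact ⟨g⁻¹, by simpa using hg, g * x, hgx, by simp⟩
  choose F hF using hcov
  let v : ℕ → ℕ := fun i => ∑ j ∈ Finset.range (i + 1), ((F j).card + 1)
  have hvmono : StrictMono v := strictMono_nat_of_lt_succ fun i => by
    simp only [v, Finset.sum_range_succ _ (i + 1)]
    omega
  have hvF : ∀ i, (F i).card + 1 ≤ v i := fun i => by
    simp only [v, Finset.sum_range_succ _ i]
    omega
  have hv1 : ∀ i, 1 ≤ v i := fun i => le_trans (by omega) (hvF i)
  have hF2 : ∀ i, (F i).card ≤ 2 ^ v i := fun i =>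
    ((Nat.le_succ _).trans (hvF i)).trans Nat.lt_two_pow_self.le
  refine ⟨v, fun n => (weightedProducts v F n : Set G) * E 0, hv1,
    fun n => (Finset.finite_toSet _).isCompact.mul (hE 0),
    ⟨1, one_mem_weightedProducts v F 0, 1, hE1, by simp⟩, fun n i => ?_, fun n => ?_⟩
  · rintro _ ⟨_, ⟨s, hs, x, hx, rfl⟩, y, hy, rfl⟩
    obtain ⟨f, hf, z, hz, hfz⟩ := hF i ⟨x, hx, y, hy, rfl⟩
    refine ⟨s * f, mul_mem_weightedProducts hvmono hv1 hs hf, z, hz, ?_⟩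
    simp only [mul_assoc] at hfz ⊢
    rw [hfz]
  · have h1 : (weightedProducts v F n : Set G) * E 0 =
        ⋃ s ∈ weightedProducts v F n, s • E 0 := by
      rw [← smul_eq_mul, ← Set.iUnion_smul_set]
      rfl
    simp only [h1]
    refine (measure_biUnion_finset_le _ _).trans ?_
    simp only [measure_smul, Finset.sum_const, nsmul_eq_mul]
    gcongr
    exact_mod_cast card_weightedProducts_le hvmono hF2 n

theorem exists_symmetric_compact_cover (G : Type*) [Group G] [TopologicalSpace G]
    [IsTopologicalGroup G] [SigmaCompactSpace G] {K : Set G} (hK : IsCompact K) :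
    ∃ E : ℕ → Set G, (∀ i, IsCompact (E i)) ∧ (∀ i, (E i)⁻¹ = E i) ∧ (∀ x, ∃ i, x ∈ E i) ∧
      K ⊆ E 0 := by
  refine ⟨fun i => (K ∪ compactCovering G i) ∪ (K ∪ compactCovering G i)⁻¹, fun i => ?_,
    fun i => ?_, fun x => ?_, fun x hx => Or.inl (Or.inl hx)⟩
  · have := hK.union (isCompact_compactCovering G i)
    exact this.union this.inv
  · rw [Set.union_inv, inv_inv, Set.union_comm]
  · obtain ⟨i, hi⟩ := exists_mem_compactCovering x
    exact ⟨i, Or.inl (Or.inr hi)⟩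

/-- Greedy grouping of a chain. A factorization `x₁ * ⋯ * xₖ` is rewritten as `a * b`, with `b` a
product of recent small factors that has not left `{ρ < 1}` yet, and with `a ∈ T n` the product of
the rest. The potential `n + 2 * v 0 * ρ b` pays for a block of small factors when it leaves
`{ρ < 1}`. -/
theorem exists_mul_eq_list_prod {G : Type*} [Group G] [TopologicalSpace G] {ρ W : G → ℝ}
    (hρ : IsCompatibleLength ρ) {E : ℕ → Set G} (hρE : ∀ x, ρ x < 1 → x ∈ E 0) {v : ℕ → ℕ}
    {T : ℕ → Set G} (hv : ∀ i, 1 ≤ v i) (hT1 : 1 ∈ T 0) (hTE : ∀ n i, T n * E i ⊆ T (n + v i))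
    (hlt : ∀ x, ρ x < 1 → W x = ρ x) (hge : ∀ x, 1 ≤ ρ x → ∃ i, x ∈ E i ∧ W x = v i)
    (l : List G) :
    ∃ (n : ℕ) (a b : G), l.prod = a * b ∧ a ∈ T n ∧ ρ b < 1 ∧
      (n : ℝ) + 2 * v 0 * ρ b ≤ 2 * v 0 * (l.map W).sum := by
  have hv0 : (1 : ℝ) ≤ v 0 := by exact_mod_cast hv 0
  induction l using List.reverseRecOn with
  | nil => exact ⟨0, 1, 1, by simp, hT1, by simp [hρ.one], by simp [hρ.one]⟩
  | append_singleton l y ih =>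
    obtain ⟨n, a, b, hl, ha, hb, hn⟩ := ih
    have hab : a * b ∈ T (n + v 0) := hTE n 0 ⟨a, ha, b, hρE b hb, rfl⟩
    have hb0 := hρ.nonneg b
    simp only [List.prod_append, List.prod_singleton, List.map_append, List.map_cons,
      List.map_nil, List.sum_append, List.sum_singleton]
    rcases lt_or_ge (ρ y) 1 with hy | hy
    · rw [hlt y hy]
      rcases lt_or_ge (ρ (b * y)) 1 with hby | hby
      · refine ⟨n, a, b * y, by rw [hl, mul_assoc], ha, hby, ?_⟩
        nlinarith [hρ.mul_le b y]
      · refine ⟨n + v 0 + v 0, a * b * y, 1, by rw [hl, mul_one],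
          hTE _ 0 ⟨a * b, hab, y, hρE y hy, rfl⟩, by simp [hρ.one], ?_⟩
        rw [hρ.one]
        push_cast
        nlinarith [hρ.mul_le b y]
    · obtain ⟨i, hi, hWi⟩ := hge y hy
      have hvi : (1 : ℝ) ≤ v i := by exact_mod_cast hv i
      refine ⟨n + v 0 + v i, a * b * y, 1, by rw [hl, mul_one],
        hTE _ i ⟨a * b, hab, y, hi, rfl⟩, by simp [hρ.one], ?_⟩
      rw [hρ.one, hWi]
      push_cast
      nlinarith [mul_nonneg (sub_nonneg.2 hv0) (sub_nonneg.2 hvi),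
        mul_nonneg (zero_le_one.trans hv0) hb0]

theorem exists_isPligMetric_hasExpControlledGrowth [BorelSpace G] [T2Space G]
    [LocallyCompactSpace G] [SecondCountableTopology G] (μ : Measure G) [μ.IsHaarMeasure] :
    ∃ m : MetricSpace G, IsPligMetric m ∧ HasExpControlledGrowth m μ := by
  classical
  obtain ⟨ρ, hρ, K, hK, hρK⟩ := exists_isCompatibleLength_lt_one_subset_isCompact G
  obtain ⟨E, hEc, hEinv, hEcov, hKE⟩ := exists_symmetric_compact_cover G hK
  have hρE : ∀ x, ρ x < 1 → x ∈ E 0 := fun x hx => hKE (hρK hx)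
  have hE1 : (1 : G) ∈ interior (E 0) :=
    mem_interior_iff_mem_nhds.2 (mem_of_superset (hρ.hasBasis.mem_of_mem one_pos) hρE)
  obtain ⟨v, T, hv, hTc, hT1, hTE, hTμ⟩ :=
    exists_weights_with_exponential_growth μ hEc (interior_subset hE1) ⟨1, hE1⟩
  -- the weight: `ρ` near `1`, and `v i` on the part of `E i` that is not in the previous sets
  let W : G → ℝ := fun x => if ρ x < 1 then ρ x else v (Nat.find (hEcov x))
  have hlt : ∀ x, ρ x < 1 → W x = ρ x := fun x hx => if_pos hx
  have hWge : ∀ x, 1 ≤ ρ x → W x = v (Nat.find (hEcov x)) := fun x hx => if_neg (not_lt.2 hx)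
  have hge : ∀ x, 1 ≤ ρ x → ∃ i, x ∈ E i ∧ W x = v i := fun x hx =>
    ⟨_, Nat.find_spec (hEcov x), hWge x hx⟩
  have hge1 : ∀ x, 1 ≤ ρ x → 1 ≤ W x := fun x hx => by
    rw [hWge x hx]
    exact_mod_cast hv _
  have hmem : ∀ x i, x⁻¹ ∈ E i ↔ x ∈ E i := fun x i => by
    rw [← Set.mem_inv, hEinv]
  have hWinv : ∀ x, W x⁻¹ = W x := fun x => by
    simp only [W, hρ.inv, hmem]
  have hℓ := isCompatibleLength_chainLength hρ hWinv hlt hge1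
  have hsub : ∀ N : ℕ, {x | chainLength W x < N} ⊆
      ⋃ n ∈ Finset.range (2 * v 0 * N + v 0 + 1), T n := fun N x hx => by
    obtain ⟨l, rfl, hl⟩ := exists_sum_lt_of_chainLength_lt (Set.mem_ofPred.1 hx)
    obtain ⟨n, a, b, hab, ha, hb, hn⟩ := exists_mul_eq_list_prod hρ hρE hv hT1 hTE hlt hge l
    refine Set.mem_iUnion₂.2 ⟨n + v 0, ?_, ?_⟩
    · have h0 : (0 : ℝ) ≤ v 0 := Nat.cast_nonneg _
      have h1 : (n : ℝ) ≤ ((2 * v 0 * N : ℕ) : ℝ) := by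
        push_cast
        nlinarith [mul_nonneg h0 (hρ.nonneg b), mul_le_mul_of_nonneg_left hl.le h0]
      have h2 : n ≤ 2 * v 0 * N := by exact_mod_cast h1
      rw [Finset.mem_range]
      omega
    · rw [hab]
      exact hTE n 0 ⟨a, ha, b, hρE b hb, rfl⟩
  refine ⟨hℓ.metricSpace, hℓ.isPligMetric fun r => ?_, ?_⟩
  · obtain ⟨N, hN⟩ := exists_nat_gt r
    exact ⟨_, Finset.isCompact_biUnion _ fun n _ => hTc n,
      fun x hx => hsub N (lt_of_le_of_lt hx hN)⟩
  · have hE0 : μ (E 0) ≠ ∞ := (hEc 0).measure_lt_top.ne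
    refine ⟨Real.log 4 * (2 * v 0), 4 ^ (v 0 + 1) * (μ (E 0)).toReal + 1, ?_, by positivity,
      fun N => ?_⟩
    · have := hv 0
      have : 0 < Real.log 4 := Real.log_pos (by norm_num)
      positivity
    have h1 : {y : G | hℓ.metricSpace.dist 1 y < N} = {x | chainLength W x < N} := by
      ext y
      simp [IsCompatibleLength.metricSpace_dist]
    have h4 : Real.exp (Real.log 4 * (2 * v 0) * N) = 4 ^ (2 * v 0 * N) := by
      rw [← Real.rpow_natCast, Real.rpow_def_of_pos (by norm_num)]
      push_cast
      ring_nf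
    rw [h1, h4]
    have h5 : ∑ n ∈ Finset.range (2 * v 0 * N + v 0 + 1), 4 ^ n ≤
        4 ^ (2 * v 0 * N + v 0 + 1) := by
      have := Nat.geomSum_eq (m := 4) (by norm_num) (2 * v 0 * N + v 0 + 1)
      rw [this]
      exact (Nat.div_le_self _ _).trans (Nat.sub_le _ _)
    calc μ {x | chainLength W x < N}
        ≤ ∑ n ∈ Finset.range (2 * v 0 * N + v 0 + 1), μ (T n) :=
          (measure_mono (hsub N)).trans (measure_biUnion_finset_le _ _)
      _ ≤ ∑ n ∈ Finset.range (2 * v 0 * N + v 0 + 1), 4 ^ n * μ (E 0) :=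
          Finset.sum_le_sum fun n _ => hTμ n
      _ ≤ 4 ^ (2 * v 0 * N + v 0 + 1) * μ (E 0) := by
          rw [← Finset.sum_mul]
          gcongr
          exact_mod_cast h5
      _ = ENNReal.ofReal (4 ^ (2 * v 0 * N + v 0 + 1) * (μ (E 0)).toReal) := by
          rw [ENNReal.ofReal_mul (by positivity), ENNReal.ofReal_toReal hE0,
            ENNReal.ofReal_pow (by norm_num)]
          norm_num
      _ ≤ _ := by
          refine ENNReal.ofReal_le_ofReal ?_
          have : (0 : ℝ) ≤ 4 ^ (2 * v 0 * N) := by positivity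
          rw [add_assoc, pow_add]
          linarith

end ExponentialGrowth

/-! ### Comparison of proper metrics on a group -/

section Comparison

theorem IsPligMetric.isCompact_setOf_dist_le {G : Type*} [Group G] [t : TopologicalSpace G]
    {m : MetricSpace G} (hm : IsPligMetric m) (R : ℝ) : IsCompact {x : G | m.dist 1 x ≤ R} := by
  obtain ⟨hp, _, rfl⟩ := hm
  convert hp.isCompact_closedBall 1 R using 1
  ext x
  exact Metric.mem_closedBall'.symm

theorem IsPligMetric.exists_dist_le_of_isCompact {G : Type*} [Group G] [t : TopologicalSpace G]
    {m : MetricSpace G} (hm : IsPligMetric m) {K : Set G} (hK : IsCompact K) :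
    ∃ C : ℝ, ∀ x ∈ K, m.dist 1 x ≤ C := by
  obtain ⟨_, _, rfl⟩ := hm
  obtain ⟨C, hC⟩ := hK.isBounded.subset_closedBall 1
  exact ⟨C, fun x hx => Metric.mem_closedBall'.1 (hC hx)⟩

/-- The control functions are `t ↦ inf {F x | t ≤ q x}` and `t ↦ sup {F x | q x ≤ t}`, with the
half-lines `[t, ∞)` and `(-∞, t]` added to these sets so that the limits are right even when `q` is
bounded. -/
theorem exists_monotone_controls {X : Type*} {F q : X → ℝ} (hF : ∀ x, 0 ≤ F x)
    (hq : ∀ x, 0 ≤ q x) (hFq : ∀ R, ∃ C, ∀ x, q x ≤ R → F x ≤ C)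
    (hqF : ∀ R, ∃ C, ∀ x, F x ≤ R → q x ≤ C) :
    ∃ ρ₁ ρ₂ : ℝ → ℝ, (∀ t, 0 ≤ t → 0 ≤ ρ₁ t) ∧ (∀ t, 0 ≤ t → 0 ≤ ρ₂ t) ∧
      MonotoneOn ρ₁ (Set.Ici 0) ∧ MonotoneOn ρ₂ (Set.Ici 0) ∧
      Tendsto ρ₁ atTop atTop ∧ Tendsto ρ₂ atTop atTop ∧
      ∀ x, ρ₁ (q x) ≤ F x ∧ F x ≤ ρ₂ (q x) := by
  let A : ℝ → Set ℝ := fun t => F '' {x | t ≤ q x} ∪ Set.Ici t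
  let B : ℝ → Set ℝ := fun t => F '' {x | q x ≤ t} ∪ Set.Iic t
  have hA0 : ∀ t, 0 ≤ t → ∀ y ∈ A t, 0 ≤ y := by
    rintro t ht _ (⟨x, _, rfl⟩ | hy)
    · exact hF x
    · exact ht.trans hy
  have hAb : ∀ t, 0 ≤ t → BddBelow (A t) := fun t ht => ⟨0, hA0 t ht⟩
  have hAn : ∀ t, (A t).Nonempty := fun t => ⟨t, Or.inr Set.self_mem_Ici⟩
  have hBb : ∀ t, BddAbove (B t) := fun t => by
    obtain ⟨C, hC⟩ := hFq t
    refine BddAbove.union ⟨C, ?_⟩ bddAbove_Iic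
    rintro _ ⟨x, hx, rfl⟩
    exact hC x hx
  have hBn : ∀ t, (B t).Nonempty := fun t => ⟨t, Or.inr Set.self_mem_Iic⟩
  have hBt : ∀ t, t ≤ sSup (B t) := fun t => le_csSup (hBb t) (Or.inr Set.self_mem_Iic)
  refine ⟨fun t => sInf (A t), fun t => sSup (B t), fun t ht => le_csInf (hAn t) (hA0 t ht),
    fun t ht => ht.trans (hBt t), fun s hs t _ hst => ?_, fun s _ t _ hst => ?_, ?_,
    tendsto_atTop_mono hBt tendsto_id, fun x => ⟨?_, ?_⟩⟩
  · refine csInf_le_csInf (hAb s hs) (hAn t) (Set.union_subset_union (Set.image_mono ?_) ?_)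
    · exact fun x hx => hst.trans hx
    · exact Set.Ici_subset_Ici.2 hst
  · refine csSup_le_csSup (hBb t) (hBn s) (Set.union_subset_union (Set.image_mono ?_) ?_)
    · exact fun x hx => le_trans hx hst
    · exact Set.Iic_subset_Iic.2 hst
  · refine tendsto_atTop.2 fun R => ?_
    obtain ⟨C, hC⟩ := hqF R
    filter_upwards [eventually_ge_atTop R, eventually_gt_atTop C] with t hR ht
    refine le_csInf (hAn t) ?_
    rintro _ (⟨x, hx, rfl⟩ | hy)
    · by_contra! hlt
      exact absurd (hC x hlt.le) (not_le.2 (ht.trans_le hx))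
    · exact hR.trans hy
  · exact csInf_le (hAb _ (hq x)) (Or.inl ⟨x, le_refl (q x), rfl⟩)
  · exact le_csSup (hBb _) (Or.inl ⟨x, le_refl (q x), rfl⟩)

end Comparison

/-! ### Translates of tent functions -/

section Tent

theorem toReal_evenExponent (n : ℕ+) : (evenExponent n).toReal = ((2 * n : ℕ) : ℝ) :=
  ENNReal.toReal_natCast _

theorem two_mul_pnat_ne_zero (n : ℕ+) : 2 * (n : ℕ) ≠ 0 := by
  have := n.pos
  omega

variable {G : Type*} [Group G] [m : MetricSpace G]

theorem tentFunction_eq_max (n : ℕ+) (y : G) :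
    tentFunction m n y = max 0 (1 - dist 1 y / n) := by
  have hn : (0 : ℝ) < n := by exact_mod_cast n.pos
  unfold tentFunction
  split_ifs with h
  · rw [max_eq_right]
    linarith [(div_le_one hn).2 h]
  · rw [max_eq_left]
    linarith [(one_lt_div hn).2 (not_le.1 h)]

theorem continuous_tentFunction (n : ℕ+) : Continuous (tentFunction m n) := by
  rw [show tentFunction m n = fun y => max 0 (1 - dist 1 y / (n : ℝ)) from
    funext (tentFunction_eq_max n)]
  fun_prop

theorem tentFunction_eq_zero {n : ℕ+} {y : G} (h : n ≤ dist 1 y) : tentFunction m n y = 0 := by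
  have hn : (0 : ℝ) < n := by exact_mod_cast n.pos
  rw [tentFunction_eq_max, max_eq_left]
  linarith [(one_le_div hn).2 h]

theorem half_le_tentFunction {n : ℕ+} {y : G} (h : dist 1 y ≤ 1 / 2) :
    1 / 2 ≤ tentFunction m n y := by
  have hn : (1 : ℝ) ≤ n := by exact_mod_cast one_le
  rw [tentFunction_eq_max]
  refine le_max_of_le_right ?_
  linarith [div_le_self (dist_nonneg (x := 1) (y := y)) hn]

theorem dist_one_inv_mul (hinv : ∀ g x y : G, dist (g * x) (g * y) = dist x y)
    (g h : G) : dist 1 (g⁻¹ * h) = dist g h := by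
  rw [← hinv g, mul_one, mul_inv_cancel_left]

theorem abs_tentFunction_sub_le (hinv : ∀ g x y : G, dist (g * x) (g * y) = dist x y)
    (n : ℕ+) (g h : G) :
    |tentFunction m n (g⁻¹ * h) - tentFunction m n h| ≤ dist 1 g / n := by
  have hn : (0 : ℝ) < n := by exact_mod_cast n.pos
  rw [tentFunction_eq_max, tentFunction_eq_max, dist_one_inv_mul hinv]
  refine (abs_max_sub_max_le_max _ _ _ _).trans (max_le (by simp; positivity) ?_)
  rw [show 1 - dist g h / (n : ℝ) - (1 - dist 1 h / n) = (dist 1 h - dist g h) / n by ring,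
    abs_div, abs_of_pos hn]
  gcongr
  exact abs_dist_sub_le 1 g h

theorem tentFunction_sub_eq_zero (hinv : ∀ g x y : G, dist (g * x) (g * y) = dist x y)
    {n : ℕ+} {g h : G}
    (hh : h ∉ Metric.ball 1 (n : ℝ) ∪ Metric.ball g (n : ℝ)) :
    tentFunction m n (g⁻¹ * h) - tentFunction m n h = 0 := by
  rw [Set.mem_union, not_or, Metric.mem_ball', Metric.mem_ball', not_lt, not_lt] at hh
  rw [tentFunction_eq_zero hh.1, tentFunction_eq_zero ((dist_one_inv_mul hinv g h).symm ▸ hh.2),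
    sub_zero]

theorem half_le_abs_tentFunction_sub (hinv : ∀ g x y : G, dist (g * x) (g * y) = dist x y)
    {n : ℕ+} {g h : G} (hg : 2 * n ≤ dist 1 g)
    (hh : dist 1 h ≤ 1 / 2) :
    1 / 2 ≤ |tentFunction m n (g⁻¹ * h) - tentFunction m n h| := by
  have hn : (1 : ℝ) ≤ n := by exact_mod_cast one_le
  rw [tentFunction_eq_zero, zero_sub, abs_neg]
  · exact (half_le_tentFunction hh).trans (le_abs_self _)
  · rw [dist_one_inv_mul hinv]
    linarith [dist_triangle_right 1 g h]

variable [MeasurableSpace G] {μ : Measure G} (𝕜 : Type*) [RCLike 𝕜]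

/-- A `2n`-th root compensates the exponential growth of the ball of radius `n`. -/
theorem eLpNorm_tentFunction_sub_le [IsTopologicalGroup G] [BorelSpace G] [μ.IsMulLeftInvariant]
    (hinv : ∀ g x y : G, dist (g * x) (g * y) = dist x y) {M : ℝ}
    {n : ℕ+} (hμ : 2 * μ (Metric.ball 1 n) ≤ ENNReal.ofReal M ^ (2 * (n : ℕ))) (g : G) :
    eLpNorm (fun h => ((tentFunction m n (g⁻¹ * h) - tentFunction m n h : ℝ) : 𝕜))
      (evenExponent n) μ ≤ ENNReal.ofReal (M * dist 1 g * (1 / n)) := by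
  have hball : μ (Metric.ball g n) = μ (Metric.ball 1 n) := by
    rw [← measure_preimage_mul μ g (Metric.ball g n)]
    congr 1
    ext x
    rw [Set.mem_preimage, Metric.mem_ball', Metric.mem_ball']
    nth_rw 1 [← mul_one g]
    rw [hinv]
  have hA : μ (Metric.ball 1 (n : ℝ) ∪ Metric.ball g (n : ℝ)) ≤
      ENNReal.ofReal M ^ (2 * (n : ℕ)) := by
    refine (measure_union_le _ _).trans ?_
    rwa [hball, ← two_mul]
  calc _ ≤ eLpNorm ((Metric.ball 1 (n : ℝ) ∪ Metric.ball g (n : ℝ)).indicator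
        fun _ => dist 1 g / (n : ℝ)) (evenExponent n) μ := by
        refine eLpNorm_mono_real fun h => ?_
        rw [RCLike.norm_ofReal]
        by_cases hh : h ∈ Metric.ball 1 (n : ℝ) ∪ Metric.ball g (n : ℝ)
        · rw [Set.indicator_of_mem hh]
          exact abs_tentFunction_sub_le hinv n g h
        · rw [Set.indicator_of_notMem hh, tentFunction_sub_eq_zero hinv hh, abs_zero]
    _ ≤ ‖dist 1 g / (n : ℝ)‖ₑ *
        μ (Metric.ball 1 (n : ℝ) ∪ Metric.ball g (n : ℝ)) ^ (1 / (evenExponent n).toReal) :=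
        eLpNorm_indicator_const_le _ _
    _ ≤ ‖dist 1 g / (n : ℝ)‖ₑ * ENNReal.ofReal M := by
        gcongr
        rw [toReal_evenExponent, one_div]
        refine (ENNReal.rpow_le_rpow hA (by positivity)).trans_eq ?_
        rw [ENNReal.pow_rpow_inv_natCast (two_mul_pnat_ne_zero n)]
    _ = _ := by
        rw [Real.enorm_of_nonneg (by positivity), ← ENNReal.ofReal_mul (by positivity)]
        congr 1
        ring

/-- If `g` is at distance at least `2n` from `1`, the two tents are disjoint, and the difference
is at least `1/2` in absolute value on a fixed ball. -/
theorem le_eLpNorm_tentFunction_sub [OpensMeasurableSpace G]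
    (hinv : ∀ g x y : G, dist (g * x) (g * y) = dist x y) {κ : ℝ}
    (hκ1 : κ ≤ 1)
    (hμ : ENNReal.ofReal κ ≤ μ (Metric.ball 1 (1 / 2))) {n : ℕ+} {g : G}
    (hg : 2 * n ≤ dist 1 g) :
    ENNReal.ofReal (κ / 2) ≤
      eLpNorm (fun h => ((tentFunction m n (g⁻¹ * h) - tentFunction m n h : ℝ) : 𝕜))
        (evenExponent n) μ := by
  calc ENNReal.ofReal (κ / 2) = ‖(1 / 2 : ℝ)‖ₑ * ENNReal.ofReal κ := by
        rw [Real.enorm_of_nonneg (by norm_num), ← ENNReal.ofReal_mul (by norm_num)]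
        congr 1
        ring
    _ ≤ ‖(1 / 2 : ℝ)‖ₑ * μ (Metric.ball 1 (1 / 2)) ^ (1 / (evenExponent n).toReal) := by
        gcongr
        rw [toReal_evenExponent, one_div ((2 * n : ℕ) : ℝ)]
        refine le_trans ?_ (ENNReal.rpow_le_rpow hμ (by positivity))
        rw [ENNReal.le_rpow_inv_iff (by exact_mod_cast (two_mul_pnat_ne_zero n).bot_lt),
          ENNReal.rpow_natCast]
        exact pow_le_of_le_one zero_le (ENNReal.ofReal_le_one.2 hκ1) (two_mul_pnat_ne_zero n)
    _ = eLpNorm ((Metric.ball (1 : G) (1 / 2)).indicator fun _ => (1 / 2 : ℝ))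
        (evenExponent n) μ :=
        (eLpNorm_indicator_const Metric.isOpen_ball.measurableSet
          (zero_lt_one.trans (one_lt_evenExponent n)).ne' (evenExponent_ne_top n)).symm
    _ ≤ _ := by
        refine eLpNorm_mono fun h => ?_
        rw [RCLike.norm_ofReal]
        by_cases hh : h ∈ Metric.ball (1 : G) (1 / 2)
        · rw [Set.indicator_of_mem hh, Real.norm_of_nonneg (by norm_num)]
          exact half_le_abs_tentFunction_sub hinv hg (Metric.mem_ball'.1 hh).le
        · rw [Set.indicator_of_notMem hh, norm_zero]
          exact abs_nonneg _

end Tent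

/-! ### The cocycle of translated tent functions -/

section Cocycle

theorem HasExpControlledGrowth.exists_pow_bound {G : Type*} [Group G] [MeasurableSpace G]
    {m : MetricSpace G} {μ : Measure G} (h : HasExpControlledGrowth m μ) :
    ∃ M : ℝ, 0 < M ∧
      ∀ n : ℕ+, 2 * μ (Metric.ball 1 (n : ℝ)) ≤ ENNReal.ofReal M ^ (2 * (n : ℕ)) := by
  obtain ⟨α, β, hα, hβ, hgr⟩ := h
  refine ⟨(1 + 2 * β) * Real.exp α, by positivity, fun n => ?_⟩
  have hball : Metric.ball (1 : G) (n : ℝ) = {y | m.dist 1 y < (n : ℕ)} :=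
    Set.ext fun y => Metric.mem_ball'
  have h1 : 2 * β ≤ (1 + 2 * β) ^ (2 * (n : ℕ)) :=
    (by linarith : 2 * β ≤ 1 + 2 * β).trans
      (le_self_pow₀ (by linarith) (two_mul_pnat_ne_zero n))
  have h2 : Real.exp (α * (n : ℕ)) ≤ Real.exp α ^ (2 * (n : ℕ)) := by
    rw [← Real.exp_nat_mul]
    refine Real.exp_le_exp.2 ?_
    push_cast
    nlinarith [(by positivity : (0 : ℝ) ≤ (n : ℕ) * α)]
  calc 2 * μ (Metric.ball 1 (n : ℝ))
      ≤ ENNReal.ofReal 2 * ENNReal.ofReal (β * Real.exp (α * (n : ℕ))) := by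
        rw [hball, ENNReal.ofReal_ofNat]
        gcongr
        exact hgr n
    _ = ENNReal.ofReal (2 * β * Real.exp (α * (n : ℕ))) := by
        rw [← ENNReal.ofReal_mul (by norm_num), mul_assoc]
    _ ≤ ENNReal.ofReal (((1 + 2 * β) * Real.exp α) ^ (2 * (n : ℕ))) := by
        refine ENNReal.ofReal_le_ofReal ?_
        rw [mul_pow]
        gcongr
    _ = _ := ENNReal.ofReal_pow (by positivity) _

variable (𝕜 : Type*) [RCLike 𝕜] {G : Type*} [Group G]

theorem cocycle_of_ae_eq {m : MetricSpace G} [MeasurableSpace G] [MeasurableMul G] {μ : Measure G}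
    [μ.IsMulLeftInvariant] {b : G → EvenLpSum 𝕜 μ}
    (hb : ∀ (g : G) (n : ℕ+), (b g n : G → 𝕜) =ᵐ[μ]
      fun h => ((tentFunction m n (g⁻¹ * h) - tentFunction m n h : ℝ) : 𝕜)) (s t : G) :
    b (s * t) = leftRegularRep 𝕜 μ s (b t) + b s := by
  refine lp.ext (funext fun n => Lp.ext ?_)
  have h1 : (leftTranslateLp 𝕜 μ (evenExponent n) s (b t n) : G → 𝕜) =ᵐ[μ] _ :=
    leftTranslateLp_coe 𝕜 μ _ s (b t n)
  have h2 := (measurePreserving_mul_left μ s⁻¹).quasiMeasurePreserving.ae_eq_comp (hb t n)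
  have h3 : ((leftRegularRep 𝕜 μ s (b t) + b s) n : G → 𝕜) =ᵐ[μ]
      (leftTranslateLp 𝕜 μ (evenExponent n) s (b t n) : G → 𝕜) + (b s n : G → 𝕜) :=
    Lp.coeFn_add (leftTranslateLp 𝕜 μ (evenExponent n) s (b t n)) (b s n)
  filter_upwards [hb (s * t) n, hb s n, h1, h2, h3] with h a1 a2 a3 a4 a5
  simp only [Function.comp_apply] at a4
  rw [a5, Pi.add_apply, a1, a2, a3, a4, mul_inv_rev, mul_assoc, ← RCLike.ofReal_add]
  congr 1
  ring

/-- The differences `φⁿ(g⁻¹ ·) - φⁿ` form a vector of the `ℓ²`-sum, of norm at most linear in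
`dist 1 g` since `∑ 1 / n ^ 2` converges, and at least of the order of `√(dist 1 g)` since about
`dist 1 g / 2` of its components have norm bounded below. -/
theorem exists_tent_cocycle [m : MetricSpace G] [IsTopologicalGroup G] [SecondCountableTopology G]
    [MeasurableSpace G] [BorelSpace G] {μ : Measure G} [μ.IsHaarMeasure]
    (hinv : ∀ g x y : G, dist (g * x) (g * y) = dist x y) (hμ : HasExpControlledGrowth m μ) :
    ∃ b : G → EvenLpSum 𝕜 μ,
      (∀ (g : G) (n : ℕ+), (b g n : G → 𝕜) =ᵐ[μ]
        fun h => ((tentFunction m n (g⁻¹ * h) - tentFunction m n h : ℝ) : 𝕜)) ∧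
      ∃ c₁ c₂ : ℝ, 0 < c₁ ∧ 0 < c₂ ∧ (∀ g, ‖b g‖ ≤ c₂ * dist 1 g) ∧
        ∀ g, 2 ≤ dist 1 g → c₁ * √(dist 1 g) ≤ ‖b g‖ := by
  obtain ⟨M, hM, hMμ⟩ := hμ.exists_pow_bound
  obtain ⟨κ, hκ0, hκ⟩ := ENNReal.lt_iff_exists_nnreal_btwn.1
    (lt_min one_pos (Metric.isOpen_ball.measure_pos μ
      ⟨(1 : G), Metric.mem_ball_self (by norm_num : (0 : ℝ) < 1 / 2)⟩))
  have hκ0' : (0 : ℝ) < κ := by exact_mod_cast hκ0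
  have hκ1 : (κ : ℝ) ≤ 1 := by exact_mod_cast (hκ.trans_le (min_le_left _ _)).le
  have hκμ : ENNReal.ofReal κ ≤ μ (Metric.ball 1 (1 / 2)) := by
    rw [ENNReal.ofReal_coe_nnreal]
    exact (hκ.trans_le (min_le_right _ _)).le
  let f : G → ℕ+ → G → 𝕜 := fun g n h =>
    ((tentFunction m n (g⁻¹ * h) - tentFunction m n h : ℝ) : 𝕜)
  have hup : ∀ g n, eLpNorm (f g n) (evenExponent n) μ ≤
      ENNReal.ofReal (M * dist 1 g * (1 / n)) := fun g n =>
    eLpNorm_tentFunction_sub_le 𝕜 hinv (hMμ n) g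
  have hmem : ∀ g n, MemLp (f g n) (evenExponent n) μ := fun g n => by
    refine ⟨Continuous.aestronglyMeasurable ?_, (hup g n).trans_lt ENNReal.ofReal_lt_top⟩
    have := continuous_tentFunction (G := G) n
    exact RCLike.continuous_ofReal.comp ((this.comp (continuous_const_mul _)).sub this)
  have h2 : (2 : ℝ≥0∞).toReal = 2 := by norm_num
  have hnorm : ∀ g n, ‖(hmem g n).toLp‖ ≤ M * dist 1 g * (1 / n) := fun g n => by
    rw [Lp.norm_toLp]
    exact ENNReal.toReal_le_of_le_ofReal (by positivity) (hup g n)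
  have hnorm_sq : ∀ g (n : ℕ+), ‖(hmem g n).toLp‖ ^ (2 : ℝ≥0∞).toReal ≤
      (M * dist 1 g) ^ 2 * (1 / (n : ℝ) ^ 2) := fun g n => by
    rw [h2, Real.rpow_two]
    refine (pow_le_pow_left₀ (norm_nonneg _) (hnorm g n) 2).trans_eq ?_
    rw [mul_pow, one_div_pow]
  have hZ : Summable fun n : ℕ+ => 1 / (n : ℝ) ^ 2 :=
    (Real.summable_one_div_nat_pow.2 one_lt_two).comp_injective PNat.coe_injective
  have hb : ∀ g, Memℓp (fun n => (hmem g n).toLp) 2 := fun g =>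
    memℓp_gen (Summable.of_nonneg_of_le (fun n => by positivity) (hnorm_sq g) (hZ.mul_left _))
  let b : G → EvenLpSum 𝕜 μ := fun g => ⟨fun n => (hmem g n).toLp, hb g⟩
  have hbn : ∀ g n, b g n = (hmem g n).toLp := fun _ _ => rfl
  clear_value b
  refine ⟨b, fun g n => by rw [hbn]; exact (hmem g n).coeFn_toLp, κ / 4,
    M * (1 + ∑' n : ℕ+, 1 / (n : ℝ) ^ 2), by positivity, ?_, fun g => ?_, fun g hg => ?_⟩
  · have : 0 ≤ ∑' n : ℕ+, 1 / (n : ℝ) ^ 2 := tsum_nonneg fun n => by positivity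
    positivity
  · set Z := ∑' n : ℕ+, 1 / (n : ℝ) ^ 2
    have hZ0 : 0 ≤ Z := tsum_nonneg fun n => by positivity
    refine (sq_le_sq₀ (norm_nonneg _) (by positivity)).1 ?_
    have h := lp.norm_rpow_eq_tsum (p := 2) (by norm_num) (b g)
    simp only [h2, Real.rpow_two, hbn] at h
    rw [h]
    calc _ ≤ ∑' n : ℕ+, (M * dist 1 g) ^ 2 * (1 / (n : ℝ) ^ 2) := by
          refine Summable.tsum_le_tsum (fun n => ?_) ?_ (hZ.mul_left _)
          · simpa only [h2, Real.rpow_two] using hnorm_sq g n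
          · simpa only [h2, Real.rpow_two] using (hb g).summable (by norm_num)
      _ = (M * dist 1 g) ^ 2 * Z := tsum_mul_left
      _ ≤ (M * dist 1 g) ^ 2 * (1 + Z) ^ 2 := by
          gcongr
          nlinarith
      _ = _ := by ring
  · refine (sq_le_sq₀ (by positivity) (norm_nonneg _)).1 ?_
    set N := ⌊dist 1 g / 2⌋₊
    have hN1 : (N : ℝ) ≤ dist 1 g / 2 := Nat.floor_le (by positivity)
    have hN2 : dist 1 g / 4 ≤ N := by
      have h3 : dist 1 g / 2 < N + 1 := Nat.lt_floor_add_one _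
      have h4 : (1 : ℝ) ≤ N := by
        exact_mod_cast (Nat.le_floor (by norm_num; linarith) : 1 ≤ N)
      linarith
    have h := lp.sum_rpow_le_norm_rpow (p := 2) (by norm_num) (b g)
      ((Finset.range N).map ⟨Nat.succPNat, Nat.succPNat_injective⟩)
    simp only [Finset.sum_map, h2, Real.rpow_two, hbn] at h
    refine le_trans ?_ h
    have hterm : ∀ k ∈ Finset.range N,
        ((κ : ℝ) / 2) ^ 2 ≤ ‖(hmem g (Nat.succPNat k)).toLp‖ ^ 2 := fun k hk => by
      refine pow_le_pow_left₀ (by positivity) ?_ 2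
      have hk' : ((k + 1 : ℕ) : ℝ) ≤ N := by exact_mod_cast Finset.mem_range.1 hk
      have hlow := le_eLpNorm_tentFunction_sub 𝕜 hinv hκ1 hκμ (n := Nat.succPNat k) (g := g)
        (by rw [Nat.succPNat_coe]; simp only [Nat.succ_eq_add_one]; linarith)
      rw [Lp.norm_toLp]
      exact (ENNReal.ofReal_le_iff_le_toReal (hmem g _).2.ne).1 hlow
    refine le_trans ?_ (Finset.card_nsmul_le_sum _ _ _ hterm)
    rw [Finset.card_range, nsmul_eq_mul, mul_pow, Real.sq_sqrt dist_nonneg]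
    nlinarith [mul_le_mul_of_nonneg_right hN2 (sq_nonneg (κ : ℝ))]

/-- Distances between values of the cocycle reduce to its norms, since `leftRegularRep` is
isometric. -/
theorem norm_sub_eq_of_cocycle (𝕜 : Type*) [RCLike 𝕜] {G : Type*} [Group G] [MeasurableSpace G]
    [MeasurableMul G] {μ : Measure G} [μ.IsMulLeftInvariant] {b : G → EvenLpSum 𝕜 μ}
    (hb : ∀ s t : G, b (s * t) = leftRegularRep 𝕜 μ s (b t) + b s) (g h : G) :
    ‖b g - b h‖ = ‖b (h⁻¹ * g)‖ := by
  have h1 := hb h (h⁻¹ * g)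
  rw [mul_inv_cancel_left] at h1
  rw [h1, add_sub_cancel_right, LinearIsometry.norm_map]

/-- The instance-free form of `exists_tent_cocycle`. -/
theorem IsPligMetric.exists_tent_cocycle (𝕜 : Type*) [RCLike 𝕜] {G : Type*} [Group G]
    [t : TopologicalSpace G] [IsTopologicalGroup G] [SecondCountableTopology G]
    [MeasurableSpace G] [BorelSpace G] {μ : Measure G} [μ.IsHaarMeasure] {m : MetricSpace G}
    (hm : IsPligMetric m) (hμ : HasExpControlledGrowth m μ) :
    ∃ b : G → EvenLpSum 𝕜 μ,
      (∀ (g : G) (n : ℕ+), (b g n : G → 𝕜) =ᵐ[μ]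
        fun h => ((tentFunction m n (g⁻¹ * h) - tentFunction m n h : ℝ) : 𝕜)) ∧
      ∃ c₁ c₂ : ℝ, 0 < c₁ ∧ 0 < c₂ ∧ (∀ g, ‖b g‖ ≤ c₂ * m.dist 1 g) ∧
        ∀ g, 2 ≤ m.dist 1 g → c₁ * √(m.dist 1 g) ≤ ‖b g‖ := by
  obtain ⟨_, hinv, rfl⟩ := hm
  exact _root_.exists_tent_cocycle 𝕜 hinv hμ

theorem IsPligMetric.dist_eq {G : Type*} [Group G] [TopologicalSpace G] {m : MetricSpace G}
    (hm : IsPligMetric m) (g h : G) : m.dist g h = m.dist 1 (h⁻¹ * g) := by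
  have := hm.left_invariant h 1 (h⁻¹ * g)
  rw [mul_one, mul_inv_cancel_left] at this
  exact (m.dist_comm g h).trans this

end Cocycle

theorem mainTheorem4 (𝕜 : Type*) [RCLike 𝕜] {G : Type*} [Group G] [TopologicalSpace G]
    [IsTopologicalGroup G] [T2Space G] [LocallyCompactSpace G] [SecondCountableTopology G]
    [MeasurableSpace G] [BorelSpace G] (μ : Measure G) [μ.IsHaarMeasure] :
    CompleteSpace (EvenLpSum 𝕜 μ) ∧
    TopologicalSpace.SeparableSpace (EvenLpSum 𝕜 μ) ∧
    StrictConvexSpace ℝ (EvenLpSum 𝕜 μ) ∧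
    ∃ (m : MetricSpace G) (b : G → EvenLpSum 𝕜 μ),
      IsPligMetric m ∧ HasExpControlledGrowth m μ ∧
      (∀ (g : G) (n : ℕ+), (b g n : G → 𝕜) =ᵐ[μ]
        fun h => ((tentFunction m n (g⁻¹ * h) - tentFunction m n h : ℝ) : 𝕜)) ∧
      (∀ s t : G, b (s * t) = leftRegularRep 𝕜 μ s (b t) + b s) ∧
      (∃ c₁ c₂ c₃ : ℝ, 0 < c₁ ∧ 0 < c₂ ∧ 0 < c₃ ∧
        ∀ g h : G, c₃ ≤ m.dist g h →
          c₁ * √(m.dist g h) ≤ ‖b g - b h‖ ∧ ‖b g - b h‖ ≤ c₂ * m.dist g h) ∧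
      ∀ m' : MetricSpace G, IsPligMetric m' →
        @IsLargeScaleUniformEmbedding G (EvenLpSum 𝕜 μ) m' _ b := by
  refine ⟨inferInstance, separableSpace_evenLpSum 𝕜 μ, strictConvexSpace_evenLpSum 𝕜 μ, ?_⟩
  obtain ⟨m, hm, hgrowth⟩ := exists_isPligMetric_hasExpControlledGrowth μ
  obtain ⟨b, hb, c₁, c₂, hc₁, hc₂, hup, hlow⟩ := hm.exists_tent_cocycle 𝕜 hgrowth
  have hcoc := cocycle_of_ae_eq 𝕜 hb
  have hsub := norm_sub_eq_of_cocycle 𝕜 hcoc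
  refine ⟨m, b, hm, hgrowth, hb, hcoc, ⟨c₁, c₂, 2, hc₁, hc₂, two_pos, fun g h hgh => ?_⟩,
    fun m' hm' => ?_⟩
  · rw [hm.dist_eq] at hgh ⊢
    rw [hsub]
    exact ⟨hlow _ hgh, hup _⟩
  · -- balls of `m` and `m'` are relatively compact, so `m` and `m'` have the same bounded sets, and
    -- by the two estimates these are the sets on which `‖b ·‖` is bounded
    have hbdd : ∀ R, ∃ C, ∀ g, m'.dist 1 g ≤ R → ‖b g‖ ≤ C := fun R => by
      obtain ⟨C, hC⟩ := hm.exists_dist_le_of_isCompact (hm'.isCompact_setOf_dist_le R)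
      exact ⟨c₂ * C, fun g hg => (hup g).trans (mul_le_mul_of_nonneg_left (hC g hg) hc₂.le)⟩
    have hproper : ∀ R, ∃ C, ∀ g, ‖b g‖ ≤ R → m'.dist 1 g ≤ C := fun R => by
      obtain ⟨C, hC⟩ := hm'.exists_dist_le_of_isCompact
        (hm.isCompact_setOf_dist_le (max 2 ((R / c₁) ^ 2)))
      refine ⟨C, fun g hg => hC g ?_⟩
      rcases le_total (m.dist 1 g) 2 with h | h
      · exact h.trans (le_max_left _ _)
      · refine le_max_of_le_right ((Real.sqrt_le_left ?_).1 ?_)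
        · exact div_nonneg ((norm_nonneg _).trans hg) hc₁.le
        · rw [le_div_iff₀ hc₁, mul_comm]
          exact (hlow g h).trans hg
    obtain ⟨ρ₁, ρ₂, h1, h2, h3, h4, h5, h6, h7⟩ :=
      exists_monotone_controls (fun g => norm_nonneg (b g)) (fun g => dist_nonneg) hbdd hproper
    refine ⟨ρ₁, ρ₂, h1, h2, h3, h4, h5, h6, fun g h => ?_⟩
    rw [dist_eq_norm, hsub, show dist g h = m'.dist 1 (h⁻¹ * g) from hm'.dist_eq g h]
    exact h7 _
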